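/- A \emph{lattice polytope} in $\mathbb{R}^d$ is a convex polytope all of whose vertices lie in $\mathbb{Z}^d$. A lattice polytope $\mathcal{P} \subset \mathbb{R}^d$ of dimension $d$ is \emph{reflexive} if the origin lies in the interior of $\mathcal{P}$ and the dual polytope $\mathcal{P}^\vee = \{x \in \mathbb{R}^d : \langle x, y\rangle \le 1 \text{ for all } y \in \mathcal{P}\}$ is a lattice polytope. For $N \ge 1$ let $N\mathcal{P} = \{Na : a \in \mathcal{P}\}$. A lattice polytope $\mathcal{P} \subset \mathbb{R}^d$ is \emph{normal} if for every $N \ge 1$ each $a \in N\mathcal{P} \cap \mathbb{Z}^d$ is a sum $a = a_1 + \cdots + a_N$ with $a_1, \dots, a_N \in \mathcal{P} \cap \mathbb{Z}^d$; it is \emph{very ample} if this holds for all sufficiently large $N$. The \emph{bipyramid} $\operatorname{bipyr}(\mathcal{P}) \subset \mathbb{R}^{d+1}$ is the convex hull of $\{(a,0) : a \in \mathcal{P}\} \cup \{(0,\dots,0,1), (0,\dots,0,-1)\}$. \textbf{Proposition.} Let $\mathcal{P} \subset \mathbb{R}^d$ be a reflexive polytope of dimension $d$. Then the following conditions are equivalent: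 (i) $\mathcal{P}$ is normal; (ii) $\operatorname{bipyr}(\mathcal{P})$ is normal; (iii) $\operatorname{bipyr}(\mathcal{P})$ is very ample. -/

import Mathlib

namespace LatticePolytope

open scoped Pointwise

/-- The points of `ℤ^d` inside `ℝ^d`. -/
def latticePoints (d : ℕ) : Set (Fin d → ℝ) :=
  {x | ∀ i, ∃ m : ℤ, x i = (m : ℝ)}

/-- A convex polytope is the convex hull of finitely many points. -/
def IsConvexPolytope {d : ℕ} (P : Set (Fin d → ℝ)) : Prop :=
  ∃ V : Set (Fin d → ℝ), V.Finite ∧ P = convexHull ℝ V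

/-- A lattice polytope is a convex polytope each of whose vertices (its extreme points)
belongs to `ℤ^d`. -/
def IsLatticePolytope {d : ℕ} (P : Set (Fin d → ℝ)) : Prop :=
  IsConvexPolytope P ∧ P.extremePoints ℝ ⊆ latticePoints d

/-- The dual polytope `P^∨ = {x : ⟨x, y⟩ ≤ 1 for all y ∈ P}`, with respect to the canonical
inner product of `ℝ^d`. -/
def dual {d : ℕ} (P : Set (Fin d → ℝ)) : Set (Fin d → ℝ) :=
  {x | ∀ y ∈ P, x ⬝ᵥ y ≤ 1}

/-- `P` is a reflexive polytope of dimension `d` in `ℝ^d`. Having dimension `d` means that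
the affine span of `P` is the whole space. -/
structure IsReflexive {d : ℕ} (P : Set (Fin d → ℝ)) : Prop where
  isLatticePolytope : IsLatticePolytope P
  full_dimensional : affineSpan ℝ P = ⊤
  zero_mem_interior : (0 : Fin d → ℝ) ∈ interior P
  dual_isLatticePolytope : IsLatticePolytope (dual P)

/-- Every lattice point of the `N`-th dilation `N P` is the sum of `N` lattice points of `P`. -/
def DecomposesAt {d : ℕ} (P : Set (Fin d → ℝ)) (N : ℕ) : Prop :=
  ∀ a ∈ ((N : ℝ) • P) ∩ latticePoints d,
    ∃ p : Fin N → (Fin d → ℝ), (∀ i, p i ∈ P ∩ latticePoints d) ∧ a = ∑ i, p i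

/-- A lattice polytope is normal if decomposition holds for each `N = 1, 2, …`. -/
def IsNormal {d : ℕ} (P : Set (Fin d → ℝ)) : Prop :=
  IsLatticePolytope P ∧ ∀ N : ℕ, 1 ≤ N → DecomposesAt P N

/-- A lattice polytope is very ample if decomposition holds for all sufficiently large `N`. -/
def IsVeryAmple {d : ℕ} (P : Set (Fin d → ℝ)) : Prop :=
  IsLatticePolytope P ∧ ∃ N₀ : ℕ, ∀ N : ℕ, N₀ ≤ N → DecomposesAt P N

/-- The bipyramid: the convex hull in `ℝ^(d+1)` of `{(a, 0) : a ∈ P}` and the two points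
`(0, …, 0, 1)` and `(0, …, 0, -1)`. -/
def bipyr {d : ℕ} (P : Set (Fin d → ℝ)) : Set (Fin (d + 1) → ℝ) :=
  convexHull ℝ
    ({x | ∃ a ∈ P, x = Fin.snoc (α := fun _ => ℝ) a 0} ∪
      {Fin.snoc (α := fun _ => ℝ) (0 : Fin d → ℝ) 1,
        Fin.snoc (α := fun _ => ℝ) (0 : Fin d → ℝ) (-1)})

end LatticePolytope

namespace LatticePolytope

open scoped Pointwise

/-! As `P` is convex and contains 0, a point (x, t) of c·bipyr(P) satisfies |t| ≤ c and x ∈ (c −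
|t|)P. If `P` is normal, a lattice point (x, t) of N·bipyr(P) splits into N − |t| lattice points of
`P` at height 0 and |t| copies of one apex (`decomposesAt_bipyr`). Conversely, x ∈ NP is lifted to
(x, M) with M large enough for very ampleness to apply at level N + M. The heights of the summands
force at most N of them to lie in `P`, and the others are apexes; padding with 0 decomposes x
(`decomposesAt_of_bipyr`). -/

theorem IsLatticePolytope.convex {d : ℕ} {P : Set (Fin d → ℝ)} (hP : IsLatticePolytope P) :
    Convex ℝ P := by
  obtain ⟨⟨V, -, rfl⟩, -⟩ := hP
  exact convex_convexHull ℝ V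

theorem smul_mono_of_zero_mem {d : ℕ} {P : Set (Fin d → ℝ)} (hc : Convex ℝ P)
    (h0 : (0 : Fin d → ℝ) ∈ P) {r s : ℝ} (hr : 0 ≤ r) (hrs : r ≤ s) : r • P ⊆ s • P := by
  intro x hx
  have h := hc.add_smul hr (sub_nonneg.2 hrs)
  rw [add_sub_cancel] at h
  rw [h]
  simpa using Set.add_mem_add hx (Set.smul_mem_smul_set (a := s - r) h0)

/-- The inclusion `a ↦ (a, 0)` of `ℝ^d` in `ℝ^(d+1)`. -/
def inclusion (d : ℕ) : (Fin d → ℝ) →ₗ[ℝ] (Fin (d + 1) → ℝ) where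
  toFun a := Fin.snoc (α := fun _ => ℝ) a 0
  map_add' a b := by
    ext i
    refine Fin.lastCases ?_ (fun j => ?_) i <;> simp
  map_smul' c a := by
    ext i
    refine Fin.lastCases ?_ (fun j => ?_) i <;> simp

theorem inclusion_apply {d : ℕ} (a : Fin d → ℝ) :
    inclusion d a = Fin.snoc (α := fun _ => ℝ) a 0 := rfl

theorem inclusion_injective (d : ℕ) : Function.Injective (inclusion d) := by
  intro a b h
  ext i
  simpa [inclusion_apply] using congrFun h i.castSucc

/-- The point `(0, …, 0, t)` of `ℝ^(d+1)`. -/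
def apex (d : ℕ) (t : ℝ) : Fin (d + 1) → ℝ := Fin.snoc (α := fun _ => ℝ) (0 : Fin d → ℝ) t

theorem smul_apex {d : ℕ} (c t : ℝ) : c • apex d t = apex d (c * t) := by
  ext i
  refine Fin.lastCases ?_ (fun j => ?_) i <;> simp [apex]

theorem inclusion_add_apex {d : ℕ} (a : Fin d → ℝ) (t : ℝ) :
    inclusion d a + apex d t = Fin.snoc (α := fun _ => ℝ) a t := by
  ext i
  refine Fin.lastCases ?_ (fun j => ?_) i <;> simp [apex, inclusion_apply]

theorem snoc_mem_latticePoints {d : ℕ} {a : Fin d → ℝ} {t : ℝ} (ha : a ∈ latticePoints d)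
    (ht : ∃ m : ℤ, t = m) : Fin.snoc (α := fun _ => ℝ) a t ∈ latticePoints (d + 1) := by
  intro i
  refine Fin.lastCases ?_ (fun j => ?_) i
  · simpa using ht
  · simpa using ha j

theorem zero_mem_latticePoints (d : ℕ) : (0 : Fin d → ℝ) ∈ latticePoints d :=
  fun _ => ⟨0, by simp⟩

theorem inclusion_mem_latticePoints {d : ℕ} {a : Fin d → ℝ} (ha : a ∈ latticePoints d) :
    inclusion d a ∈ latticePoints (d + 1) :=
  snoc_mem_latticePoints ha ⟨0, by simp⟩

theorem apex_mem_latticePoints (d : ℕ) (m : ℤ) : apex d m ∈ latticePoints (d + 1) :=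
  snoc_mem_latticePoints (zero_mem_latticePoints d) ⟨m, rfl⟩

theorem bipyr_eq {d : ℕ} (P : Set (Fin d → ℝ)) :
    bipyr P = convexHull ℝ (inclusion d '' P ∪ {apex d 1, apex d (-1)}) := by
  have : {x | ∃ a ∈ P, x = Fin.snoc (α := fun _ => ℝ) a 0} = inclusion d '' P := by
    ext x
    simp [inclusion_apply, eq_comm]
  rw [bipyr, this]
  rfl

theorem convex_bipyr {d : ℕ} (P : Set (Fin d → ℝ)) : Convex ℝ (bipyr P) :=
  convex_convexHull ℝ _

theorem inclusion_mem_bipyr {d : ℕ} {P : Set (Fin d → ℝ)} {a : Fin d → ℝ} (ha : a ∈ P) :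
    inclusion d a ∈ bipyr P := by
  rw [bipyr_eq]
  exact subset_convexHull ℝ _ (Or.inl ⟨a, ha, rfl⟩)

theorem apex_one_mem_bipyr {d : ℕ} (P : Set (Fin d → ℝ)) : apex d 1 ∈ bipyr P := by
  rw [bipyr_eq]
  exact subset_convexHull ℝ _ (by simp)

theorem apex_neg_one_mem_bipyr {d : ℕ} (P : Set (Fin d → ℝ)) : apex d (-1) ∈ bipyr P := by
  rw [bipyr_eq]
  exact subset_convexHull ℝ _ (by simp)

theorem isLatticePolytope_bipyr {d : ℕ} {P : Set (Fin d → ℝ)} (hP : IsLatticePolytope P) :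
    IsLatticePolytope (bipyr P) := by
  obtain ⟨⟨V, hV, hPV⟩, hext⟩ := hP
  refine ⟨⟨inclusion d '' V ∪ {apex d 1, apex d (-1)},
    (hV.image _).union (Set.toFinite _), ?_⟩, fun x hx => ?_⟩
  · rw [bipyr_eq, hPV, (inclusion d).image_convexHull, convexHull_convexHull_union_left]
  · have hx' : x ∈ inclusion d '' P ∪ {apex d 1, apex d (-1)} := by
      rw [bipyr_eq] at hx
      exact extremePoints_convexHull_subset hx
    rcases hx' with ⟨a, ha, rfl⟩ | rfl | rfl
    -- An open segment in `P` through `a` maps to one in the bipyramid, so extremality descends to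
    -- `a`.
    · refine inclusion_mem_latticePoints (hext ⟨ha, fun b hb c hc habc => ?_⟩)
      have h := hx.2 (inclusion_mem_bipyr hb) (inclusion_mem_bipyr hc)
        (by
          rw [← LinearMap.coe_toAffineMap, ← image_openSegment]
          exact ⟨a, habc, rfl⟩)
      exact inclusion_injective d h
    · simpa using apex_mem_latticePoints d 1
    · simpa using apex_mem_latticePoints d (-1)

/-- Each point `(x, t)` of the bipyramid over `P` has `x ∈ rP` for some `0 ≤ r ≤ 1 - |t|`. -/
theorem exists_of_mem_bipyr {d : ℕ} {P : Set (Fin d → ℝ)} (hc : Convex ℝ P)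
    (h0 : (0 : Fin d → ℝ) ∈ P) {z : Fin (d + 1) → ℝ} (hz : z ∈ bipyr P) :
    ∃ r : ℝ, 0 ≤ r ∧ r + |z (Fin.last d)| ≤ 1 ∧ (fun i : Fin d => z i.castSucc) ∈ r • P := by
  rw [bipyr_eq] at hz
  refine convexHull_min (t := {z : Fin (d + 1) → ℝ | ∃ r : ℝ, 0 ≤ r ∧
    r + |z (Fin.last d)| ≤ 1 ∧ (fun i : Fin d => z i.castSucc) ∈ r • P}) ?_ ?_ hz
  · have hapex : ∀ t : ℝ, (fun i : Fin d => apex d t i.castSucc) ∈ (0 : ℝ) • P := fun t =>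
      ⟨0, h0, by ext i; simp [apex]⟩
    rintro x (⟨a, ha, rfl⟩ | rfl | rfl)
    · exact ⟨1, zero_le_one, by simp [inclusion_apply], by simpa [inclusion_apply] using ha⟩
    · exact ⟨0, le_rfl, by simp [apex], hapex _⟩
    · exact ⟨0, le_rfl, by simp [apex], hapex _⟩
  · rintro x ⟨r, hr, hrx, hx⟩ y ⟨s, hs, hsy, hy⟩ α β hα hβ hαβ
    -- Convexity gives (αr + βs)P = αrP + βsP, so the radii combine like the points.
    refine ⟨α * r + β * s, by positivity, ?_, ?_⟩
    · have h := abs_add_le (α * x (Fin.last d)) (β * y (Fin.last d))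
      rw [abs_mul, abs_mul, abs_of_nonneg hα, abs_of_nonneg hβ] at h
      have h₁ := mul_le_mul_of_nonneg_left hrx hα
      have h₂ := mul_le_mul_of_nonneg_left hsy hβ
      simp only [Pi.add_apply, Pi.smul_apply, smul_eq_mul]
      linarith
    · rw [hc.add_smul (by positivity) (by positivity), mul_smul, mul_smul]
      exact Set.add_mem_add (Set.smul_mem_smul_set hx) (Set.smul_mem_smul_set hy)

theorem mem_smul_of_mem_smul_bipyr {d : ℕ} {P : Set (Fin d → ℝ)} (hc : Convex ℝ P)
    (h0 : (0 : Fin d → ℝ) ∈ P) {c : ℝ} (hc0 : 0 ≤ c) {z : Fin (d + 1) → ℝ}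
    (hz : z ∈ c • bipyr P) :
    |z (Fin.last d)| ≤ c ∧
      (fun i : Fin d => z i.castSucc) ∈ (c - |z (Fin.last d)|) • P := by
  obtain ⟨w, hw, rfl⟩ := hz
  obtain ⟨r, hr, hrw, hm⟩ := exists_of_mem_bipyr hc h0 hw
  have h := mul_le_mul_of_nonneg_left hrw hc0
  have hcr : 0 ≤ c * r := by positivity
  simp only [Pi.smul_apply, smul_eq_mul, abs_mul, abs_of_nonneg hc0]
  refine ⟨by linarith, smul_mono_of_zero_mem hc h0 hcr (by linarith) ?_⟩
  rw [mul_smul]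
  exact Set.smul_mem_smul_set hm

theorem inclusion_add_apex_mem_smul_bipyr {d : ℕ} {P : Set (Fin d → ℝ)} {r s : ℝ} (hr : 0 ≤ r)
    (hs : 0 ≤ s) {x : Fin d → ℝ} (hx : x ∈ r • P) :
    inclusion d x + apex d s ∈ (r + s) • bipyr P := by
  obtain ⟨a, ha, rfl⟩ := hx
  rw [(convex_bipyr P).add_smul hr hs]
  refine Set.add_mem_add ?_ ⟨apex d 1, apex_one_mem_bipyr P, by simp [smul_apex]⟩
  rw [map_smul]
  exact Set.smul_mem_smul_set (inclusion_mem_bipyr ha)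

/-- A sum of `k` members of `A` and `m` copies of a member of `A` is a sum of `k + m` members. -/
theorem exists_sum_add_nsmul {M : Type*} [AddCommMonoid M] {A : Set M} {k : ℕ} (p : Fin k → M)
    (hp : ∀ i, p i ∈ A) {b : M} (hb : b ∈ A) (m : ℕ) :
    ∃ q : Fin (k + m) → M, (∀ i, q i ∈ A) ∧ (∑ i, p i) + m • b = ∑ i, q i := by
  refine ⟨Fin.append p fun _ => b, fun i => ?_, by simp [Fin.sum_univ_add]⟩
  refine Fin.addCases (fun j => ?_) (fun j => ?_) i
  · simpa using hp j
  · simpa using hb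

theorem exists_sum_of_card_le {M ι : Type*} [AddCommMonoid M] {A : Set M} (h0 : (0 : M) ∈ A)
    (S : Finset ι) (f : ι → M) (hf : ∀ i ∈ S, f i ∈ A) {N : ℕ} (hN : S.card ≤ N) :
    ∃ q : Fin N → M, (∀ i, q i ∈ A) ∧ ∑ i ∈ S, f i = ∑ i, q i := by
  obtain ⟨m, rfl⟩ := Nat.exists_eq_add_of_le hN
  obtain ⟨q, hq, hsum⟩ := exists_sum_add_nsmul (fun i => f (S.equivFin.symm i))
    (fun i => hf _ (S.equivFin.symm i).2) h0 m
  refine ⟨q, hq, ?_⟩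
  rw [← hsum, smul_zero, add_zero, S.equivFin.symm.sum_comp (fun i : S => f i),
    Finset.sum_coe_sort]

/-- Normality starts at N = 1, but level 0 occurs when removing the apexes leaves no summand. -/
theorem decomposesAt_zero {d : ℕ} (P : Set (Fin d → ℝ)) : DecomposesAt P 0 := by
  rintro a ⟨⟨b, -, rfl⟩, -⟩
  exact ⟨Fin.elim0, fun i => i.elim0, by simp⟩

theorem decomposesAt_bipyr {d : ℕ} {P : Set (Fin d → ℝ)} (hc : Convex ℝ P)
    (h0 : (0 : Fin d → ℝ) ∈ P) (h : ∀ N, DecomposesAt P N) (N : ℕ) :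
    DecomposesAt (bipyr P) N := by
  rintro z ⟨hz, hzl⟩
  obtain ⟨hle, hmem⟩ := mem_smul_of_mem_smul_bipyr hc h0 N.cast_nonneg hz
  obtain ⟨t, ht⟩ := hzl (Fin.last d)
  have habs : |z (Fin.last d)| = (t.natAbs : ℝ) := by rw [ht, Nat.cast_natAbs, Int.cast_abs]
  rw [habs] at hle hmem
  obtain ⟨k, rfl⟩ := Nat.exists_eq_add_of_le' (Nat.cast_le.1 hle)
  rw [Nat.cast_add, add_sub_cancel_right] at hmem
  obtain ⟨p, hp, hsum⟩ := h k _ ⟨hmem, fun i => hzl i.castSucc⟩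
  have hapex : ∃ e ∈ bipyr P ∩ latticePoints (d + 1), t.natAbs • e = apex d t := by
    rcases Int.natAbs_eq t with h | h
    · refine ⟨apex d 1, ⟨apex_one_mem_bipyr P, by simpa using apex_mem_latticePoints d 1⟩, ?_⟩
      rw [← Nat.cast_smul_eq_nsmul ℝ, smul_apex, mul_one]
      conv_rhs => rw [h, Int.cast_natCast]
    · refine ⟨apex d (-1),
        ⟨apex_neg_one_mem_bipyr P, by simpa using apex_mem_latticePoints d (-1)⟩, ?_⟩
      rw [← Nat.cast_smul_eq_nsmul ℝ, smul_apex, mul_neg, mul_one]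
      conv_rhs => rw [h, Int.cast_neg, Int.cast_natCast]
  obtain ⟨e, he, hte⟩ := hapex
  obtain ⟨q, hq, hqsum⟩ := exists_sum_add_nsmul
    (A := bipyr P ∩ latticePoints (d + 1)) (fun i => inclusion d (p i))
    (fun i => ⟨inclusion_mem_bipyr (hp i).1, inclusion_mem_latticePoints (hp i).2⟩) he t.natAbs
  refine ⟨q, hq, ?_⟩
  rw [← hqsum, hte, ← map_sum, ← hsum, inclusion_add_apex, ← ht]
  exact (Fin.snoc_init_self (α := fun _ => ℝ) z).symm

/-- If `(x, M)` decomposes into `N + M` lattice points of the bipyramid, then at most `N` of these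
have last coordinate zero, and those with last coordinate `±1` do not contribute to `x`. -/
theorem decomposesAt_of_bipyr {d : ℕ} {P : Set (Fin d → ℝ)} (hc : Convex ℝ P)
    (h0 : (0 : Fin d → ℝ) ∈ P) {N M : ℕ} (h : DecomposesAt (bipyr P) (N + M)) :
    DecomposesAt P N := by
  rintro x ⟨hx, hxl⟩
  have hmem := inclusion_add_apex_mem_smul_bipyr N.cast_nonneg M.cast_nonneg hx
  rw [← Nat.cast_add, inclusion_add_apex] at hmem
  obtain ⟨p, hp, hsum⟩ := h _ ⟨hmem, snoc_mem_latticePoints hxl ⟨M, by simp⟩⟩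
  have hlast : (M : ℝ) = ∑ i, p i (Fin.last d) := by
    simpa using congrFun hsum (Fin.last d)
  have hinit : x = ∑ i, fun j : Fin d => p i j.castSucc := by
    ext j
    simpa using congrFun hsum j.castSucc
  have hp' := fun i => mem_smul_of_mem_smul_bipyr hc h0 zero_le_one
    (by simpa using (hp i).1 : p i ∈ (1 : ℝ) • bipyr P)
  -- A nonzero integer height of absolute value at most 1 is ±1, leaving the radius 1 − 1 = 0.
  have hzero : ∀ i, p i (Fin.last d) ≠ 0 → (fun j : Fin d => p i j.castSucc) = 0 := by
    intro i hi
    obtain ⟨hle, hm⟩ := hp' i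
    obtain ⟨t, ht⟩ := (hp i).2 (Fin.last d)
    have hone : (1 : ℝ) ≤ |p i (Fin.last d)| := by
      rw [ht] at hi ⊢
      exact_mod_cast Int.one_le_abs (by exact_mod_cast hi)
    rw [le_antisymm hle hone, sub_self] at hm
    obtain ⟨a, -, ha⟩ := hm
    rw [← ha]
    exact zero_smul ℝ a
  classical
  let S := Finset.univ.filter fun i => p i (Fin.last d) = 0
  have hcard : S.card ≤ N := by
    -- Summing this bound over all summands gives M ≤ (N + M) − |S|.
    have hle : ∀ i, p i (Fin.last d) ≤ 1 - if p i (Fin.last d) = 0 then 1 else 0 := by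
      intro i
      split_ifs with hi
      · simp [hi]
      · simpa using (le_abs_self _).trans (hp' i).1
    have := Finset.sum_le_sum fun i (_ : i ∈ Finset.univ) => hle i
    rw [← hlast, Finset.sum_sub_distrib, Finset.sum_boole] at this
    simp only [Finset.sum_const, Finset.card_univ, Fintype.card_fin, nsmul_eq_mul, mul_one,
      Nat.cast_add] at this
    exact_mod_cast (by linarith : (S.card : ℝ) ≤ N)
  obtain ⟨q, hq, hqsum⟩ := exists_sum_of_card_le (A := P ∩ latticePoints d)
    ⟨h0, zero_mem_latticePoints d⟩ S (fun i (j : Fin d) => p i j.castSucc)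
    (fun i hi => ⟨by simpa [(Finset.mem_filter.1 hi).2] using (hp' i).2,
      fun j => (hp i).2 j.castSucc⟩) hcard
  refine ⟨q, hq, ?_⟩
  rw [← hqsum, hinit]
  exact (Finset.sum_subset (Finset.subset_univ S) fun i _ hi =>
    hzero i fun h => hi (by simp [S, h])).symm

end LatticePolytope

theorem mainTheorem2 {d : ℕ} (P : Set (Fin d → ℝ)) (hP : LatticePolytope.IsReflexive P) :
    List.TFAE
      [LatticePolytope.IsNormal P,
        LatticePolytope.IsNormal (LatticePolytope.bipyr P),
        LatticePolytope.IsVeryAmple (LatticePolytope.bipyr P)] := by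
  have hc := hP.isLatticePolytope.convex
  have h0 := interior_subset hP.zero_mem_interior
  tfae_have 1 → 2 := fun h =>
    ⟨LatticePolytope.isLatticePolytope_bipyr h.1, fun N _ =>
      LatticePolytope.decomposesAt_bipyr hc h0 (fun N => by
        rcases N.eq_zero_or_pos with rfl | hN
        · exact LatticePolytope.decomposesAt_zero P
        · exact h.2 N hN) N⟩
  tfae_have 2 → 3 := fun h => ⟨h.1, 1, h.2⟩
  -- Taking M = N₀ puts every level N + M in the very ample range.
  tfae_have 3 → 1 := fun ⟨_, N₀, h⟩ =>
    ⟨hP.isLatticePolytope, fun N _ =>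
      LatticePolytope.decomposesAt_of_bipyr hc h0 (h (N + N₀) (Nat.le_add_left N₀ N))⟩
  tfae_finish
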